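/- Let $p,q\ge 0$ be integers. Consider the crossbar array with input-side nodes $a_0,\dots,a_p$ and output-side nodes $b_0,\dots,b_q$, in which every $a_k$ is joined to every $b_j$ by a linear resistor of resistance $0<r_{kj}<\infty$ (no resistor is open or short). For $k=1,\dots,p$ an input port is connected between $a_k$ (positive terminal) and the common input node $a_0$. For $j=1,\dots,q$ an output port and, in parallel with it, a diode are connected between $b_j$ (positive terminal) and the common output node $b_0$. Replace the $q$ diodes by ports. Port currents are counted as positive when they leave the network at the positive terminal. Take as inputs the currents at the output ports, the voltages at the input ports and the voltages at the diodes, $\mathbf u=(\mathbf i_q,\mathbf v_p,\mathbf v_{\mathrm{diode}})$, and as outputs the dual variables $\mathbf y=(\mathbf v_q,\mathbf i_p,\mathbf i_{\mathrm{diode}})$. Then there is exactly one real matrix $\tilde H$ (the hybrid matrix) such that the port voltages and currents permitted by Ohm's law and Kirchhoff's laws are exactly those with $\mathbf y=\tilde H\mathbf u$. Partition it as $$\tilde H=-\begin{pmatrix} D & C\\ B & H\end{pmatrix},\qquad D=\begin{pmatrix} D_{11} & D_{12}\\ D_{21} & D_{22}\end{pmatrix},$$ where $D$ is $(q+p)\times(q+p)$,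 $H$ is $q\times q$, $D_{11}$ is $q\times q$ and $D_{22}$ is $p\times p$. Then $D_{11}=0$, and $D_{22}$ and $H$ are Stieltjes matrices, i.e. symmetric positive definite matrices with nonpositive off-diagonal entries. -/

import Mathlib

/-- A multiport network of linear resistors: a finite directed multigraph with node set `V`, one
resistor of resistance `res e` on each edge `e : E`, and a family of ports (driving points)
`k : P`, each of which is a pair of terminals located at nodes of the graph. -/
structure ResistiveMultiport (V E P : Type*) where
  /-- initial node of a resistive edge -/
  src : E → V
  /-- final node of a resistive edge -/
  tgt : E → V
  /-- resistance of a resistive edge -/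
  res : E → ℝ
  /-- positive terminal of a port -/
  pos : P → V
  /-- negative terminal of a port -/
  neg : P → V

namespace ResistiveMultiport

variable {V E P : Type*} [DecidableEq V] [Fintype E] [Fintype P]

/-- Driving point behavior: `v` and `i` are the port voltages and port currents of some solution
of the circuit equations. A port current is positive if it leaves the network at the positive
terminal of the port (and enters it again at the negative terminal). -/
def Behavior (N : ResistiveMultiport V E P) (v i : P → ℝ) : Prop :=
  ∃ (φ : V → ℝ) (c : E → ℝ),
    -- Ohm's law; Kirchhoff's voltage law holds as the voltages are differences of potentials
    (∀ e, φ (N.src e) - φ (N.tgt e) = N.res e * c e) ∧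
    (∀ k, v k = φ (N.pos k) - φ (N.neg k)) ∧
    -- Kirchhoff's current law: the currents that leave the node `n` add up to zero
    (∀ n, (∑ e, ((if N.src e = n then c e else 0) - (if N.tgt e = n then c e else 0))) +
        (∑ k, ((if N.pos k = n then i k else 0) - (if N.neg k = n then i k else 0))) = 0)

end ResistiveMultiport

/-- The two kinds of port variables. -/
inductive PortVariable where
  | voltage
  | current

/-- The electrical dual of a kind of port variable. -/
def PortVariable.dual : PortVariable → PortVariable
  | voltage => current
  | current => voltage

/-- Selects the voltage `v` or the current `i`. -/
def PortVariable.select : PortVariable → ℝ → ℝ → ℝ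
  | voltage, v, _ => v
  | current, _, i => i

/-- `Ht` is the hybrid matrix of the network `N` when, at each port `k`, the variable of kind
`inp k` is the input and its electrical dual is the output: the driving point behavior of `N` is
exactly the set of solutions of `y = Ht u`, where `u` holds the inputs and `y` the outputs. -/
def ResistiveMultiport.IsHybridMatrix {V E P : Type*} [DecidableEq V] [Fintype E] [Fintype P]
    (N : ResistiveMultiport V E P) (inp : P → PortVariable) (Ht : Matrix P P ℝ) : Prop :=
  ∀ v i : P → ℝ, N.Behavior v i ↔
    (fun k => (inp k).dual.select (v k) (i k)) =
      Matrix.mulVec Ht (fun k => (inp k).select (v k) (i k))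

/-- Ports of the crossbar array, in the order: `q` output ports, `p` input ports, and the `q` ports
left by the extracted diodes. -/
abbrev CrossbarPort (p q : ℕ) : Type := (Fin q ⊕ Fin p) ⊕ Fin q

/-- The crossbar array with `p` input ports, `q` output ports and `q` diodes, the diodes being
replaced by ports. There are `p + 1` nodes `Sum.inl k` on the input side and `q + 1` nodes
`Sum.inr j` on the output side, `Sum.inl 0` and `Sum.inr 0` being the common node of each side. A
resistor `r k j` joins every node `k` of the input side to every node `j` of the output side. Each
input port joins a non-common input node to the common input node; each output port and, in
parallel with it, each diode joins a non-common output node to the common output node. -/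
def crossbar {p q : ℕ} (r : Fin (p + 1) → Fin (q + 1) → ℝ) :
    ResistiveMultiport (Fin (p + 1) ⊕ Fin (q + 1)) (Fin (p + 1) × Fin (q + 1))
      (CrossbarPort p q) where
  src e := Sum.inl e.1
  tgt e := Sum.inr e.2
  res e := r e.1 e.2
  pos := Sum.elim (Sum.elim (fun j => Sum.inr j.succ) (fun k => Sum.inl k.succ))
    (fun j => Sum.inr j.succ)
  neg := Sum.elim (Sum.elim (fun _ => Sum.inr 0) (fun _ => Sum.inl 0)) (fun _ => Sum.inr 0)

/-- Inputs of the crossbar array: currents at the output ports, voltages at the input ports,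
voltages at the diodes. -/
def crossbarInput (p q : ℕ) : CrossbarPort p q → PortVariable :=
  Sum.elim (Sum.elim (fun _ => .current) (fun _ => .voltage)) (fun _ => .voltage)

/-- A Stieltjes matrix: a real symmetric positive definite matrix whose off-diagonal entries are
nonpositive. -/
def IsStieltjes {n : Type*} (A : Matrix n n ℝ) : Prop :=
  A.IsSymm ∧ A.PosDef ∧ ∀ i j, i ≠ j → A i j ≤ 0

/-! Let `d` be the voltage from `a_0` to `b_0`, `x` the input port voltages and `w` the diode
voltages, extended by zero at the common nodes. Ohm's law gives the current `(d + x_k - w_j) / r_kj`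
in each resistor. Port currents cancel within each side, so the resistor currents add up to zero;
this one equation fixes `d`, the total conductance being positive. Every port current is then
explicit. With `w = 0` the output nodes have one common potential, so the input ports see a star
whose branches are the row sums of the conductances; its reduced matrix is `D₂₂`. With `x = 0` the
column sums give `H` likewise. Such a matrix is Stieltjes by the power identity
`groundedMesh_dotProduct`. Finally `D₁₁ = 0`, since an output port voltage is just the voltage of
the parallel diode, whatever the port currents. -/

/-! ### Star networks and Stieltjes matrices -/

/-- The conductance matrix of a star with conductances `α` after elimination of its center, grounded
at the terminal `0`. -/
noncomputable def groundedMesh {n : ℕ} (α : Fin (n + 1) → ℝ) : Matrix (Fin n) (Fin n) ℝ :=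
  Matrix.of fun k l => (if k = l then α k.succ else 0) - α k.succ * α l.succ / ∑ m, α m

theorem groundedMesh_mulVec {n : ℕ} (α : Fin (n + 1) → ℝ) (x : Fin n → ℝ) (k : Fin n) :
    (groundedMesh α).mulVec x k =
      α k.succ * x k - α k.succ * (∑ l : Fin n, α l.succ * x l) / ∑ m, α m := by
  simp only [groundedMesh, Matrix.mulVec, dotProduct, Matrix.of_apply, sub_mul, ite_mul, zero_mul,
    Finset.sum_sub_distrib, Finset.sum_ite_eq, Finset.mem_univ, if_true, Finset.mul_sum,
    Finset.sum_div]
  congr 1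
  exact Finset.sum_congr rfl fun l _ => by ring

/-- The power dissipated in the star, branch by branch: the center sits at the conductance-weighted
mean of the terminal potentials, terminal `0` being at potential zero. -/
theorem groundedMesh_dotProduct {n : ℕ} (α : Fin (n + 1) → ℝ) (hα : ∀ k, 0 < α k)
    (x : Fin n → ℝ) :
    dotProduct x ((groundedMesh α).mulVec x) =
      α 0 * ((∑ l : Fin n, α l.succ * x l) / ∑ m, α m) ^ 2 +
        ∑ k : Fin n, α k.succ * (x k - (∑ l : Fin n, α l.succ * x l) / ∑ m, α m) ^ 2 := by
  have hG : 0 < ∑ m, α m := Finset.sum_pos (fun k _ => hα k) Finset.univ_nonempty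
  set G := ∑ m, α m with hGdef
  set S := ∑ l : Fin n, α l.succ * x l with hS
  have hsum : ∑ k : Fin n, α k.succ = G - α 0 := by rw [hGdef, Fin.sum_univ_succ]; ring
  have h1 : dotProduct x ((groundedMesh α).mulVec x) =
      ∑ k : Fin n, α k.succ * x k ^ 2 - S * (S / G) := by
    conv_rhs => rw [hS, Finset.sum_mul, ← hS, ← Finset.sum_sub_distrib]
    refine Finset.sum_congr rfl fun k _ => ?_
    rw [groundedMesh_mulVec]
    ring
  have h2 : ∑ k : Fin n, α k.succ * (x k - S / G) ^ 2 =
      ∑ k : Fin n, α k.succ * x k ^ 2 - 2 * (S / G) * S + (G - α 0) * (S / G) ^ 2 := by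
    rw [← hsum, Finset.sum_mul, hS, Finset.mul_sum, ← hS, ← Finset.sum_sub_distrib,
      ← Finset.sum_add_distrib]
    exact Finset.sum_congr rfl fun k _ => by ring
  rw [h1, h2]
  field_simp
  ring

theorem isStieltjes_groundedMesh {n : ℕ} (α : Fin (n + 1) → ℝ) (hα : ∀ k, 0 < α k) :
    IsStieltjes (groundedMesh α) := by
  have hG : 0 < ∑ m, α m := Finset.sum_pos (fun k _ => hα k) Finset.univ_nonempty
  have hsymm : (groundedMesh α).IsSymm := by
    ext k l
    by_cases h : k = l
    · simp [h]
    · simp [groundedMesh, h, Ne.symm h, mul_comm]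
  refine ⟨hsymm, ?_, fun k l hkl => ?_⟩
  · refine Matrix.PosDef.of_dotProduct_mulVec_pos ?_ fun x hx => ?_
    · rw [Matrix.IsHermitian, Matrix.conjTranspose_eq_transpose_of_trivial]
      exact hsymm
    rw [star_trivial, groundedMesh_dotProduct α hα]
    set d := (∑ l : Fin n, α l.succ * x l) / ∑ m, α m
    have hnn : ∀ k ∈ Finset.univ, 0 ≤ α (Fin.succ k) * (x k - d) ^ 2 := fun k _ =>
      mul_nonneg (hα _).le (sq_nonneg _)
    -- If the center is at potential zero, a terminal with `x k ≠ 0` dissipates power; otherwise the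
    -- grounded branch does.
    by_cases hd : d = 0
    · obtain ⟨k, hk⟩ := Function.ne_iff.1 hx
      refine add_pos_of_nonneg_of_pos (mul_nonneg (hα 0).le (sq_nonneg d))
        (Finset.sum_pos' hnn ⟨k, Finset.mem_univ k, mul_pos (hα _) ?_⟩)
      rw [hd, sub_zero]
      exact sq_pos_iff.2 hk
    · exact add_pos_of_pos_of_nonneg (mul_pos (hα 0) (by positivity)) (Finset.sum_nonneg hnn)
  · simp only [groundedMesh, Matrix.of_apply, if_neg hkl, zero_sub, neg_nonpos]
    exact div_nonneg (mul_nonneg (hα _).le (hα _).le) hG.le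

/-- Every pair `(u, y)` comes from some port voltages and currents, so the behavior determines the
graph of `u ↦ Ht u`. -/
theorem ResistiveMultiport.IsHybridMatrix.unique {V E P : Type*} [DecidableEq V] [Fintype E]
    [Fintype P] {N : ResistiveMultiport V E P} {inp : P → PortVariable} {A B : Matrix P P ℝ}
    (hA : N.IsHybridMatrix inp A) (hB : N.IsHybridMatrix inp B) : A = B := by
  refine Matrix.mulVec_injective (funext fun u => ?_)
  have key : ∀ y : P → ℝ, y = A.mulVec u ↔ y = B.mulVec u := by
    intro y
    have h := (hA (fun k => (inp k).select (u k) (y k))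
      (fun k => (inp k).select (y k) (u k))).symm.trans (hB _ _)
    have h1 : (fun k => (inp k).select ((inp k).select (u k) (y k))
        ((inp k).select (y k) (u k))) = u := by
      funext k; cases inp k <;> rfl
    have h2 : (fun k => (inp k).dual.select ((inp k).select (u k) (y k))
        ((inp k).select (y k) (u k))) = y := by
      funext k; cases inp k <;> rfl
    rwa [h1, h2] at h
  exact (key _).1 rfl

/-! ### Circuit equations of the crossbar -/

/-- The behavior of the crossbar array in terms of the voltage `d` between the two common nodes and
the resistor currents `c`. -/
theorem crossbar_behavior_iff {p q : ℕ} (r : Fin (p + 1) → Fin (q + 1) → ℝ)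
    (hr : ∀ k j, 0 < r k j) (v i : CrossbarPort p q → ℝ) :
    (crossbar r).Behavior v i ↔
      (∀ j : Fin q, v (.inl (.inl j)) = v (.inr j)) ∧
      ∃ d : ℝ, ∃ c : Fin (p + 1) → Fin (q + 1) → ℝ,
        (∀ k j, c k j = (r k j)⁻¹ *
          (d + (Fin.cons 0 (fun k => v (.inl (.inr k))) : Fin (p + 1) → ℝ) k -
            (Fin.cons 0 (fun j => v (.inr j)) : Fin (q + 1) → ℝ) j)) ∧
        (∑ k, ∑ j, c k j = 0) ∧
        (∀ k : Fin p, i (.inl (.inr k)) = -∑ j, c k.succ j) ∧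
        (∀ j : Fin q, i (.inr j) = -i (.inl (.inl j)) + ∑ k, c k j.succ) := by
  have kcl : ∀ c : Fin (p + 1) → Fin (q + 1) → ℝ,
      (∀ n, (∑ e : Fin (p + 1) × Fin (q + 1), ((if (crossbar r).src e = n then c e.1 e.2 else 0) -
          (if (crossbar r).tgt e = n then c e.1 e.2 else 0))) +
        (∑ k, ((if (crossbar r).pos k = n then i k else 0) -
          (if (crossbar r).neg k = n then i k else 0))) = 0) ↔
      (∑ k, ∑ j, c k j = 0) ∧
        (∀ k : Fin p, i (.inl (.inr k)) = -∑ j, c k.succ j) ∧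
        (∀ j : Fin q, i (.inr j) = -i (.inl (.inl j)) + ∑ k, c k j.succ) := by
    intro c
    have hin : ∀ m : Fin (p + 1), (∑ k, ∑ j, if k = m then c k j else 0) = ∑ j, c m j := by
      intro m
      rw [Finset.sum_comm]
      simp
    simp only [crossbar, Sum.forall, Fin.forall_fin_succ, Fintype.sum_prod_type,
      Fintype.sum_sum_type, Sum.elim_inl, Sum.elim_inr, Sum.inl.injEq, Sum.inr.injEq,
      reduceCtorEq, if_false, sub_zero, zero_sub, Finset.sum_ite_eq',
      Finset.sum_sub_distrib, hin, Finset.mem_univ, if_true, Fin.succ_ne_zero, Fin.succ_inj,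
      Finset.sum_const_zero, (Fin.succ_ne_zero _).symm, zero_add, add_zero]
    -- Given the laws at the other nodes of its side, the current law at either common node says
    -- that the total resistor current is zero; one equation thus replaces two.
    have hrow : ∑ k, ∑ j, c k j = ∑ j, c 0 j + ∑ k : Fin p, ∑ j, c k.succ j := Fin.sum_univ_succ _
    have hcol : ∑ k, ∑ j, c k j = ∑ k, c k 0 + ∑ j : Fin q, ∑ k, c k j.succ := by
      rw [Finset.sum_comm]; exact Fin.sum_univ_succ _
    constructor
    · rintro ⟨⟨ha0, ha⟩, hb0, hb⟩
      have ha' : ∀ k : Fin p, i (.inl (.inr k)) = -∑ j, c k.succ j := fun k => by linarith [ha k]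
      refine ⟨?_, ha', fun j => by linarith [hb j]⟩
      simp only [ha', Finset.sum_neg_distrib] at ha0
      linarith
    · rintro ⟨h0, ha, hb⟩
      refine ⟨⟨?_, fun k => by linarith [ha k]⟩, ?_, fun j => by linarith [hb j]⟩
      · simp only [ha, Finset.sum_neg_distrib]
        linarith
      · simp only [hb, Finset.sum_add_distrib, Finset.sum_neg_distrib]
        linarith
  constructor
  · rintro ⟨φ, c, ohm, kvl, hc⟩
    have hout : ∀ j : Fin q, v (.inl (.inl j)) = φ (.inr j.succ) - φ (.inr 0) := fun j => kvl _
    have hin : ∀ k : Fin p, v (.inl (.inr k)) = φ (.inl k.succ) - φ (.inl 0) := fun k => kvl _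
    have hdio : ∀ j : Fin q, v (.inr j) = φ (.inr j.succ) - φ (.inr 0) := fun j => kvl _
    refine ⟨fun j => by rw [hout, hdio], φ (.inl 0) - φ (.inr 0), fun k j => c (k, j), ?_,
      (kcl fun k j => c (k, j)).1 hc⟩
    intro k j
    have h : φ (.inl k) - φ (.inr j) = r k j * c (k, j) := ohm (k, j)
    rw [eq_inv_mul_iff_mul_eq₀ (hr k j).ne', ← h]
    refine Fin.cases ?_ (fun k => ?_) k <;> refine Fin.cases ?_ (fun j => ?_) j <;>
      simp only [Fin.cons_zero, Fin.cons_succ, hin, hdio] <;> ring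
  · rintro ⟨hv, d, c, ohm, hc⟩
    -- Potentials are measured from `b_0`, so `a_0` has potential `d`.
    refine ⟨Sum.elim (fun k => d + (Fin.cons 0 (fun k => v (.inl (.inr k))) : Fin (p + 1) → ℝ) k)
      (Fin.cons 0 (fun j => v (.inr j)) : Fin (q + 1) → ℝ), fun e => c e.1 e.2, ?_, ?_,
      (kcl c).2 hc⟩
    · rintro ⟨k, j⟩
      simp only [crossbar, Sum.elim_inl, Sum.elim_inr, ohm]
      rw [mul_inv_cancel_left₀ (hr k j).ne']
    · rintro ((j | k) | j) <;> simp [crossbar, hv]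

/-! ### The explicit hybrid matrix -/

/-- The total conductance at an input-side node of the crossbar array. -/
noncomputable def inputConductance {p q : ℕ} (r : Fin (p + 1) → Fin (q + 1) → ℝ) :
    Fin (p + 1) → ℝ := fun k => ∑ j, (r k j)⁻¹

/-- The total conductance at an output-side node of the crossbar array. -/
noncomputable def outputConductance {p q : ℕ} (r : Fin (p + 1) → Fin (q + 1) → ℝ) :
    Fin (q + 1) → ℝ := fun j => ∑ k, (r k j)⁻¹

/-- Transfer conductances between the input ports and the diodes of the crossbar array. -/
noncomputable def transferConductance {p q : ℕ} (r : Fin (p + 1) → Fin (q + 1) → ℝ) :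
    Matrix (Fin p) (Fin q) ℝ :=
  Matrix.of fun k j => (r k.succ j.succ)⁻¹ -
    inputConductance r k.succ * outputConductance r j.succ / ∑ m, inputConductance r m

/-- The hybrid matrix of the crossbar array. -/
noncomputable def crossbarHybrid {p q : ℕ} (r : Fin (p + 1) → Fin (q + 1) → ℝ) :
    Matrix (CrossbarPort p q) (CrossbarPort p q) ℝ :=
  -Matrix.fromBlocks (Matrix.fromBlocks 0 0 0 (groundedMesh (inputConductance r)))
    (Matrix.fromRows (-1) (-transferConductance r))
    (Matrix.fromCols 1 (-(transferConductance r).transpose))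
    (groundedMesh (outputConductance r))

theorem sum_inputConductance_eq {p q : ℕ} (r : Fin (p + 1) → Fin (q + 1) → ℝ) :
    ∑ k, inputConductance r k = ∑ j, outputConductance r j := Finset.sum_comm

theorem inputConductance_pos {p q : ℕ} {r : Fin (p + 1) → Fin (q + 1) → ℝ}
    (hr : ∀ k j, 0 < r k j) (k : Fin (p + 1)) : 0 < inputConductance r k :=
  Finset.sum_pos (fun j _ => inv_pos.2 (hr k j)) Finset.univ_nonempty

theorem outputConductance_pos {p q : ℕ} {r : Fin (p + 1) → Fin (q + 1) → ℝ}
    (hr : ∀ k j, 0 < r k j) (j : Fin (q + 1)) : 0 < outputConductance r j :=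
  Finset.sum_pos (fun k _ => inv_pos.2 (hr k j)) Finset.univ_nonempty

theorem isHybridMatrix_crossbarHybrid {p q : ℕ} (r : Fin (p + 1) → Fin (q + 1) → ℝ)
    (hr : ∀ k j, 0 < r k j) :
    (crossbar r).IsHybridMatrix (crossbarInput p q) (crossbarHybrid r) := by
  intro v i
  have hG : 0 < ∑ m, inputConductance r m :=
    Finset.sum_pos (fun k _ => inputConductance_pos hr k) Finset.univ_nonempty
  set G := ∑ m, inputConductance r m with hGdef
  set x : Fin p → ℝ := fun k => v (.inl (.inr k)) with hx
  set w : Fin q → ℝ := fun j => v (.inr j) with hw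
  set X : ℝ := ∑ k : Fin p, inputConductance r k.succ * x k with hX
  set W : ℝ := ∑ j : Fin q, outputConductance r j.succ * w j with hW
  have row : ∀ (d : ℝ) (k : Fin (p + 1)), ∑ j, (r k j)⁻¹ *
      (d + (Fin.cons 0 x : Fin (p + 1) → ℝ) k - (Fin.cons 0 w : Fin (q + 1) → ℝ) j) =
      inputConductance r k * (d + (Fin.cons 0 x : Fin (p + 1) → ℝ) k) -
        ∑ j : Fin q, (r k j.succ)⁻¹ * w j := by
    intro d k
    simp only [mul_sub, Finset.sum_sub_distrib, ← Finset.sum_mul]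
    congr 1
    simp [Fin.sum_univ_succ]
  have col : ∀ (d : ℝ) (j : Fin (q + 1)), ∑ k, (r k j)⁻¹ *
      (d + (Fin.cons 0 x : Fin (p + 1) → ℝ) k - (Fin.cons 0 w : Fin (q + 1) → ℝ) j) =
      outputConductance r j * (d - (Fin.cons 0 w : Fin (q + 1) → ℝ) j) +
        ∑ k : Fin p, (r k.succ j)⁻¹ * x k := by
    intro d j
    simp only [add_sub_right_comm, mul_add, Finset.sum_add_distrib, ← Finset.sum_mul]
    congr 1
    simp [Fin.sum_univ_succ]
  have total : ∀ d : ℝ, ∑ k, ∑ j, (r k j)⁻¹ *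
      (d + (Fin.cons 0 x : Fin (p + 1) → ℝ) k - (Fin.cons 0 w : Fin (q + 1) → ℝ) j) =
      G * d + X - W := by
    intro d
    simp only [row, Finset.sum_sub_distrib, mul_add, Finset.sum_add_distrib, ← Finset.sum_mul]
    congr 1
    · rw [Fin.sum_univ_succ]
      simp [hX, Fin.sum_univ_succ, hGdef]
    · rw [Finset.sum_comm]
      simp only [← Finset.sum_mul]
      rfl
  -- The inputs leave no freedom in `d`; substituting this value eliminates the only internal
  -- unknown.
  have hd : ∀ d : ℝ, G * d + X - W = 0 ↔ d = (W - X) / G := by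
    intro d
    rw [eq_div_iff hG.ne']
    constructor <;> intro h <;> linarith
  have htr : ∀ k : Fin p, (transferConductance r).mulVec w k =
      ∑ j : Fin q, (r k.succ j.succ)⁻¹ * w j - inputConductance r k.succ * (W / G) := by
    intro k
    simp only [transferConductance, Matrix.mulVec, dotProduct, Matrix.of_apply, sub_mul,
      Finset.sum_sub_distrib, hW, Finset.sum_div, Finset.mul_sum]
    congr 1
    exact Finset.sum_congr rfl fun j _ => by ring
  have htr' : ∀ j : Fin q, (transferConductance r).transpose.mulVec x j =
      ∑ k : Fin p, (r k.succ j.succ)⁻¹ * x k - outputConductance r j.succ * (X / G) := by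
    intro j
    simp only [transferConductance, Matrix.mulVec, dotProduct, Matrix.transpose_apply,
      Matrix.of_apply, sub_mul, Finset.sum_sub_distrib, hX, Finset.sum_div, Finset.mul_sum]
    congr 1
    exact Finset.sum_congr rfl fun k _ => by ring
  have hu : (fun k => (crossbarInput p q k).select (v k) (i k)) =
      Sum.elim (Sum.elim (fun j => i (.inl (.inl j))) x) w := by
    funext k
    rcases k with (j | k) | j <;> rfl
  have hmul : (crossbarHybrid r).mulVec (Sum.elim (Sum.elim (fun j => i (.inl (.inl j))) x) w) =
      Sum.elim (Sum.elim w (fun k => -(inputConductance r k.succ * ((W - X) / G + x k) -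
          ∑ j : Fin q, (r k.succ j.succ)⁻¹ * w j)))
        (fun j => -i (.inl (.inl j)) + (outputConductance r j.succ * ((W - X) / G - w j) +
          ∑ k : Fin p, (r k.succ j.succ)⁻¹ * x k)) := by
    funext k
    rcases k with (j | k) | j
    · simp [crossbarHybrid, Matrix.neg_mulVec, Matrix.fromBlocks_mulVec, Matrix.fromRows_mulVec]
    · simp [crossbarHybrid, Matrix.neg_mulVec, Matrix.fromBlocks_mulVec, Matrix.fromRows_mulVec,
        groundedMesh_mulVec, htr, ← hGdef, ← hX]
      ring
    · simp [crossbarHybrid, Matrix.neg_mulVec, Matrix.fromBlocks_mulVec,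
        groundedMesh_mulVec, htr', ← hGdef, ← hW, ← sum_inputConductance_eq]
      ring
  rw [crossbar_behavior_iff r hr, hu, hmul]
  have hy : (fun k => (crossbarInput p q k).dual.select (v k) (i k)) =
      Sum.elim (Sum.elim (fun j => v (.inl (.inl j))) (fun k => i (.inl (.inr k))))
        (fun j => i (.inr j)) := by
    funext k
    rcases k with (j | k) | j <;> rfl
  rw [hy, Sum.elim_eq_iff, Sum.elim_eq_iff, funext_iff, funext_iff, funext_iff, and_assoc]
  refine and_congr_right fun _ => ?_
  constructor
  · rintro ⟨d, c, hc, h0, hi, ho⟩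
    simp only [hc] at h0 hi ho
    obtain rfl := (hd d).1 ((total d).symm.trans h0)
    refine ⟨fun k => ?_, fun j => ?_⟩
    · rw [hi, row, Fin.cons_succ]
    · rw [ho, col, Fin.cons_succ]
  · rintro ⟨hi, ho⟩
    refine ⟨(W - X) / G, _, fun k j => rfl, ?_, fun k => ?_, fun j => ?_⟩
    · exact (total _).trans ((hd _).2 rfl)
    · rw [hi, row, Fin.cons_succ]
    · rw [ho, col, Fin.cons_succ]

theorem mainTheorem3 (p q : ℕ) (r : Fin (p + 1) → Fin (q + 1) → ℝ) (hr : ∀ k j, 0 < r k j) :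
    (∃! Ht : Matrix (CrossbarPort p q) (CrossbarPort p q) ℝ,
      (crossbar r).IsHybridMatrix (crossbarInput p q) Ht) ∧
    ∀ (D : Matrix (Fin q ⊕ Fin p) (Fin q ⊕ Fin p) ℝ) (C : Matrix (Fin q ⊕ Fin p) (Fin q) ℝ)
      (B : Matrix (Fin q) (Fin q ⊕ Fin p) ℝ) (H : Matrix (Fin q) (Fin q) ℝ)
      (D₁₁ : Matrix (Fin q) (Fin q) ℝ) (D₁₂ : Matrix (Fin q) (Fin p) ℝ)
      (D₂₁ : Matrix (Fin p) (Fin q) ℝ) (D₂₂ : Matrix (Fin p) (Fin p) ℝ),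
      (crossbar r).IsHybridMatrix (crossbarInput p q) (-Matrix.fromBlocks D C B H) →
      D = Matrix.fromBlocks D₁₁ D₁₂ D₂₁ D₂₂ →
      D₁₁ = 0 ∧ IsStieltjes D₂₂ ∧ IsStieltjes H
 := by
  have hyb := isHybridMatrix_crossbarHybrid r hr
  refine ⟨⟨_, hyb, fun A hA => hA.unique hyb⟩, ?_⟩
  intro D C B H D₁₁ D₁₂ D₂₁ D₂₂ h hD
  obtain ⟨hD', -, -, rfl⟩ := Matrix.fromBlocks_inj.1 (neg_injective (h.unique hyb))
  obtain ⟨rfl, -, -, rfl⟩ := Matrix.fromBlocks_inj.1 (hD.symm.trans hD')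
  exact ⟨rfl, isStieltjes_groundedMesh _ (inputConductance_pos hr),
    isStieltjes_groundedMesh _ (outputConductance_pos hr)⟩
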